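/- Let $N_0,N_1,N\ge 1$, let $x_1,\dots,x_N\in\mathbb R^{N_0}$, $X=(x_1,\dots,x_N)$, $\lambda_1,\lambda_2,\beta>0$ and $\theta>\frac1N\|X\|_F^2$. Write $z=(\mathrm{vec}(W),b_1,b_2,\mathrm{vec}(V))\in\mathbb R^{N_2}$ with $W\in\mathbb R^{N_1\times N_0}$, $b_1\in\mathbb R^{N_1}$, $b_2\in\mathbb R^{N_0}$, $V=(v_1,\dots,v_N)\in\mathbb R^{N_1\times N}$, $N_2=N_0N_1+N_1+N_0+N_1N$, and let $y_+=\max\{0,y\}$ componentwise and $e=(1,\dots,1)^\top$. Put $$\mathcal F(z)=\tfrac1N\sum_n\|(W^\top v_n+b_2)_+-x_n\|_2^2,\quad \mathcal R(z)=\lambda_1\sum_n e^\top v_n+\lambda_2\|W\|_F^2,\quad \mathcal P(z)=\beta\sum_n e^\top\big(v_n-(Wx_n+b_1)_+\big),$$ $\mathcal O=\mathcal F+\mathcal R+\mathcal P$, $\Omega_2=\{z: v_n\ge (Wx_n+b_1)_+\ \forall n\}$, $\Omega_\theta=\{z\in\Omega_2:\mathcal O(z)\le\theta\}$, and let (LRP)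 be the problem of minimizing $\mathcal O$ over $\mathcal Z=\Omega_2\cap\{z:\|(b_1,b_2)\|_\infty\le\alpha\}$, where, with $\|X\|_1=\sum_{i,n}|X_{i,n}|$, $$\alpha=\max\Big\{\tfrac{\theta}{\lambda_1}+\sqrt{\tfrac{N_1N_0\theta}{\lambda_2}}\,\|X\|_1,\ \tfrac{\theta\sqrt{N_1N_0\theta}}{\lambda_1\sqrt{\lambda_2}}+\sqrt{N\theta}+\|X\|_1\Big\}.$$ For $\mu>0$ let $\tilde\sigma(y,\mu)=0$ if $y<0$, $\frac{y^2}{2\mu}$ if $0\le y\le\mu$, $y-\frac\mu2$ if $y>\mu$ (componentwise), and $$\tilde{\mathcal F}(z,\mu)=\tfrac1N\sum_n\|(W^\top v_n+b_2)_+\|_2^2+\tfrac1N\|X\|_F^2-\tfrac2N\sum_n x_n^\top\tilde\sigma(W^\top v_n+b_2,\mu),$$ $$\tilde{\mathcal P}(z,\mu)=\beta\sum_n e^\top\big(v_n-\tilde\sigma(Wx_n+b_1,\mu)\big),\qquad \tilde{\mathcal H}=\tilde{\mathcal F}+\tilde{\mathcal P},\qquad \tilde{\mathcal O}=\tilde{\mathcal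 H}+\mathcal R.$$ Let $\eta=\max\{\sqrt{N_1N_0\theta/\lambda_2},\,\theta/\lambda_1\}$, and let $L_{\tilde{\mathcal H}}$ and $L_{\nabla\tilde{\mathcal H}}$ be Lipschitz constants in $z$, uniform in $\mu\in(0,1)$, of $\mu\tilde{\mathcal H}(z,\mu)$ on $\Omega_\theta\cap\mathcal Z$ and of $\mu\nabla_z\tilde{\mathcal H}(z,\mu)$ on $\{z:\|z\|_\infty\le\max\{\alpha,2\eta\}\}$, respectively. The smoothing proximal gradient (SPG) algorithm takes $z^{(0)}\in\mathcal Z$, $0<\mu^{(0)}<1$, $0<\tau_1<1$, $\tau_2>0$, $\tau_3\ge1$, $L^{(0)}\ge1$, and for $k=0,1,2,\dots$ lets $z^{(k+1)}$ be the minimizer over $z\in\mathcal Z$ of $$\langle\nabla_z\tilde{\mathcal H}(z^{(k)},\mu^{(k)}),z-z^{(k)}\rangle+\mathcal R(z)+\tfrac{L^{(k)}}2\|z-z^{(k)}\|_2^2,$$ and sets $(\mu^{(k+1)},L^{(k+1)})=(\mu^{(k)},L^{(k)})$ if $\tilde{\mathcal O}(z^{(k+1)},\mu^{(k)})-\tilde{\mathcal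 O}(z^{(k)},\mu^{(k)})<-\tau_2\frac{\mu^{(k)}}{L^{(k)}}$, and $(\mu^{(k+1)},L^{(k+1)})=(\tau_1\mu^{(k)},\tau_3L^{(k)})$ otherwise. **Theorem.** Suppose that $\tau_1\tau_3\ge1$, that $$\mu^{(0)}L^{(0)}\ge\max\Big\{6\lambda_2N_1N_0+\tfrac2\eta\big(N_2L_{\tilde{\mathcal H}}+\lambda_1N_1N\big),\ 8\lambda_2+L_{\nabla\tilde{\mathcal H}}\Big\},$$ and that $$\tilde{\mathcal O}(z^{(0)},\mu^{(0)})+\tfrac{\mu^{(0)}}N\sum_{n,i}\max\{-X_{i,n},0\}<\theta .$$ (For entrywise nonnegative $X$ the last condition reads $\tilde{\mathcal O}(z^{(0)},\mu^{(0)})<\theta$. It implies $\mathcal O(z^{(0)})<\theta$, and if $\mathcal O(z^{(0)})<\theta$ then it holds for all sufficiently small $\mu^{(0)}$; for nonnegative $X$ it always holds with $z^{(0)}=0$.) Let $\mathcal K=\{k\ge0:\mu^{(k+1)}=\tau_1\mu^{(k)}\}$. Then $\{z^{(k)}:k\in\mathcal K\}$ is bounded, and any accumulation point $z^*$ of $\{z^{(k)}:k\in\mathcal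 K\}$, that is, any limit of a subsequence with indices in $\mathcal K$, is a generalized d-stationary point of (LRP): $z^*\in\mathcal Z$ and $$\mathcal O^\circ(z^*;d)=\limsup_{z\to z^*,\,t\downarrow0}\frac{\mathcal O(z+td)-\mathcal O(z)}t\ge0\quad\text{for all } d\in\mathcal T_{\mathcal Z}(z^*),$$ where $\mathcal T_{\mathcal Z}(z^*)$ is the cone of all limits of $(z-z^*)/\tau$ with $z\in\mathcal Z$, $z\to z^*$, $\tau\downarrow0$. Moreover, if $\mathcal O$ is regular at $z^*$ (for every $d$ the one-sided directional derivative $\mathcal O'(z^*;d)$ exists and equals $\mathcal O^\circ(z^*;d)$), then $z^*$ is a d-stationary point of (LRP): $\mathcal O'(z^*;d)\ge0$ for all $d\in\mathcal T_{\mathcal Z}(z^*)$. -/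

import Mathlib

open Filter Topology Set
open scoped NNReal

noncomputable section

namespace Autoencoder

/-! ### Nonsmooth analysis on a real normed space -/

section Nonsmooth

variable {E : Type*} [NormedAddCommGroup E] [NormedSpace ℝ E]

/-- The one-sided directional derivative `f'(z; d)` exists and equals `l`. -/
def HasDirDeriv (f : E → ℝ) (z d : E) (l : ℝ) : Prop :=
  Tendsto (fun t : ℝ => (f (z + t • d) - f z) / t) (𝓝[>] 0) (𝓝 l)

/-- Clarke's generalized directional derivative
`f°(z; d) = limsup_{y → z, t ↓ 0} (f (y + t d) - f y) / t`, with values in the extended reals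
(it is finite if `f` is Lipschitz near `z`). -/
def clarkeDeriv (f : E → ℝ) (z d : E) : EReal :=
  limsup (fun p : E × ℝ => (((f (p.1 + p.2 • d) - f p.1) / p.2 : ℝ) : EReal)) (𝓝 z ×ˢ 𝓝[>] 0)

/-- Clarke regularity: all directional derivatives `f'(z; d)` exist and equal `f°(z; d)`. -/
def ClarkeRegularAt (f : E → ℝ) (z : E) : Prop :=
  ∀ d : E, ∃ l : ℝ, HasDirDeriv f z d l ∧ (l : EReal) = clarkeDeriv f z d

/-- The (Bouligand) tangent cone of `S` at `z`: all limits of `(y - z) / τ` with `y ∈ S`,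
`y → z`, `τ ↓ 0`. -/
def bouligandCone (S : Set E) (z : E) : Set E :=
  {d | ∃ (y : ℕ → E) (τ : ℕ → ℝ), (∀ n, y n ∈ S) ∧ (∀ n, 0 < τ n) ∧
    Tendsto y atTop (𝓝 z) ∧ Tendsto τ atTop (𝓝 0) ∧
    Tendsto (fun n => (τ n)⁻¹ • (y n - z)) atTop (𝓝 d)}

/-- `z` is a d(irectional)-stationary point of `min f` over `S`:
`f'(z; d) ≥ 0` (the derivative exists) for all tangent directions `d`. -/
def IsDStationary (f : E → ℝ) (S : Set E) (z : E) : Prop :=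
  z ∈ S ∧ ∀ d ∈ bouligandCone S z, ∃ l : ℝ, HasDirDeriv f z d l ∧ 0 ≤ l

/-- `z` is a generalized d-stationary point of `min f` over `S`:
`f°(z; d) ≥ 0` for all tangent directions `d`. -/
def IsGenDStationary (f : E → ℝ) (S : Set E) (z : E) : Prop :=
  z ∈ S ∧ ∀ d ∈ bouligandCone S z, 0 ≤ clarkeDeriv f z d

end Nonsmooth

/-! ### The regularized autoencoder -/

/-- The ReLU function `y₊`. -/
def relu (y : ℝ) : ℝ := max 0 y

/-- The smoothing function of the ReLU with smoothing parameter `μ`. -/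
def smoothRelu (y μ : ℝ) : ℝ :=
  if y < 0 then 0 else if y ≤ μ then y ^ 2 / (2 * μ) else y - μ / 2

/-- Coordinates of `z = (vec W, b₁, b₂, vec V)` with `W ∈ ℝ^{N₁ × N₀}`, `b₁ ∈ ℝ^{N₁}`,
`b₂ ∈ ℝ^{N₀}`, `V ∈ ℝ^{N₁ × N}`. -/
abbrev Idx (N₀ N₁ N : ℕ) : Type :=
  (Fin N₁ × Fin N₀) ⊕ (Fin N₁ ⊕ Fin N₀) ⊕ (Fin N₁ × Fin N)

/-- The space `ℝ^{N₂}` of the variable `z`, `N₂ = N₀ N₁ + N₁ + N₀ + N₁ N`,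
with the Euclidean norm. -/
abbrev Var (N₀ N₁ N : ℕ) : Type := EuclideanSpace ℝ (Idx N₀ N₁ N)

section Coordinates

variable {N₀ N₁ N : ℕ}

/-- The entry `W_{j,i}`. -/
def wt (z : Var N₀ N₁ N) (j : Fin N₁) (i : Fin N₀) : ℝ := z (Sum.inl (j, i))

/-- The entry `j` of `b₁`. -/
def bias₁ (z : Var N₀ N₁ N) (j : Fin N₁) : ℝ := z (Sum.inr (Sum.inl (Sum.inl j)))

/-- The entry `i` of `b₂`. -/
def bias₂ (z : Var N₀ N₁ N) (i : Fin N₀) : ℝ := z (Sum.inr (Sum.inl (Sum.inr i)))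

/-- The entry `j` of `v_n`. -/
def aux (z : Var N₀ N₁ N) (n : Fin N) (j : Fin N₁) : ℝ := z (Sum.inr (Sum.inr (j, n)))

end Coordinates

/-- The data of the model: the data matrix `X = (x_1, …, x_N)`, the regularization parameters
`λ₁`, `λ₂`, the penalty parameter `β` and the level `θ`. -/
structure Model (N₀ N₁ N : ℕ) where
  X : Matrix (Fin N₀) (Fin N) ℝ
  lam₁ : ℝ
  lam₂ : ℝ
  β : ℝ
  θ : ℝ

namespace Model

variable {N₀ N₁ N : ℕ} (P : Model N₀ N₁ N)

/-- `‖X‖_1`, the sum of the absolute values of the entries. -/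
def normX₁ : ℝ := ∑ n, ∑ i, |P.X i n|

/-- `‖X‖_F²`. -/
def normXFsq : ℝ := ∑ n, ∑ i, P.X i n ^ 2

/-- The entry `j` of `W x_n + b₁`. -/
def pre₁ (z : Var N₀ N₁ N) (n : Fin N) (j : Fin N₁) : ℝ :=
  ∑ i, wt z j i * P.X i n + bias₁ z j

/-- The entry `i` of `Wᵀ v_n + b₂`. -/
def pre₂ (_P : Model N₀ N₁ N) (z : Var N₀ N₁ N) (n : Fin N) (i : Fin N₀) : ℝ :=
  ∑ j, wt z j i * aux z n j + bias₂ z i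

/-- The fidelity term `𝓕(z) = (1/N) ∑_n ‖(Wᵀ v_n + b₂)₊ - x_n‖²`. -/
def fidelity (z : Var N₀ N₁ N) : ℝ :=
  1 / N * ∑ n, ∑ i, (relu (P.pre₂ z n i) - P.X i n) ^ 2

/-- The regularization term `𝓡(z) = λ₁ ∑_n eᵀ v_n + λ₂ ‖W‖_F²`. -/
def regularizer (z : Var N₀ N₁ N) : ℝ :=
  P.lam₁ * ∑ n, ∑ j, aux z n j + P.lam₂ * ∑ j, ∑ i, wt z j i ^ 2

/-- The penalty term `𝓟(z) = β ∑_n eᵀ (v_n - (W x_n + b₁)₊)`. -/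
def penalty (z : Var N₀ N₁ N) : ℝ :=
  P.β * ∑ n, ∑ j, (aux z n j - relu (P.pre₁ z n j))

/-- The objective function `𝓞 = 𝓕 + 𝓡 + 𝓟`. -/
def objective (z : Var N₀ N₁ N) : ℝ := P.fidelity z + P.regularizer z + P.penalty z

/-- The bound `α` on the biases. -/
def α : ℝ :=
  max (P.θ / P.lam₁ + √(N₁ * N₀ * P.θ / P.lam₂) * P.normX₁)
    (P.θ * √(N₁ * N₀ * P.θ) / (P.lam₁ * √P.lam₂) + √(N * P.θ) + P.normX₁)

/-- `Ω₂ = {z : v_n ≥ (W x_n + b₁)₊ for all n}`. -/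
def Ω₂ : Set (Var N₀ N₁ N) := {z | ∀ n j, relu (P.pre₁ z n j) ≤ aux z n j}

/-- `Ω₃ = {z : ‖b‖_∞ ≤ α}`. -/
def Ω₃ : Set (Var N₀ N₁ N) := {z | (∀ j, |bias₁ z j| ≤ P.α) ∧ ∀ i, |bias₂ z i| ≤ P.α}

/-- The feasible set `𝓩 = Ω₂ ∩ Ω₃` of (LRP). -/
def feasible : Set (Var N₀ N₁ N) := P.Ω₂ ∩ P.Ω₃

/-- The level set `Ω_θ = {z ∈ Ω₂ : 𝓞(z) ≤ θ}`. -/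
def levelSet : Set (Var N₀ N₁ N) := {z | z ∈ P.Ω₂ ∧ P.objective z ≤ P.θ}

/-- The smoothing function of the fidelity term. -/
def smoothFidelity (z : Var N₀ N₁ N) (μ : ℝ) : ℝ :=
  1 / N * (∑ n, ∑ i, relu (P.pre₂ z n i) ^ 2) + 1 / N * P.normXFsq
    - 2 / N * ∑ n, ∑ i, P.X i n * smoothRelu (P.pre₂ z n i) μ

/-- The smoothing function of the penalty term. -/
def smoothPenalty (z : Var N₀ N₁ N) (μ : ℝ) : ℝ :=
  P.β * ∑ n, ∑ j, (aux z n j - smoothRelu (P.pre₁ z n j) μ)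

/-- `𝓗̃ = 𝓕̃ + 𝓟̃`. -/
def smoothH (z : Var N₀ N₁ N) (μ : ℝ) : ℝ := P.smoothFidelity z μ + P.smoothPenalty z μ

/-- `𝓞̃ = 𝓗̃ + 𝓡`, the smoothing function of the objective. -/
def smoothObjective (z : Var N₀ N₁ N) (μ : ℝ) : ℝ := P.smoothH z μ + P.regularizer z

/-- `∇_z 𝓗̃(z, μ)`. -/
def gradH (z : Var N₀ N₁ N) (μ : ℝ) : Var N₀ N₁ N := gradient (fun y => P.smoothH y μ) z

/-- `η = max {√(N₁ N₀ θ / λ₂), θ / λ₁}`. -/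
def η : ℝ := max √(N₁ * N₀ * P.θ / P.lam₂) (P.θ / P.lam₁)

/-- The box `{z : ‖z‖_∞ ≤ max {α, 2 η}}`. -/
def box : Set (Var N₀ N₁ N) := {z | ∀ i, |z i| ≤ max P.α (2 * P.η)}

/-- `C` is a Lipschitz constant of `z ↦ μ 𝓗̃(z, μ)` on `Ω_θ ∩ 𝓩`, uniformly in `μ ∈ (0, 1)`. -/
def IsLipConstH (C : ℝ≥0) : Prop :=
  ∀ μ ∈ Ioo (0 : ℝ) 1, LipschitzOnWith C (fun z => μ * P.smoothH z μ) (P.levelSet ∩ P.feasible)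

/-- `C` is a Lipschitz constant of `z ↦ μ ∇_z 𝓗̃(z, μ)` on the box `‖z‖_∞ ≤ max {α, 2 η}`,
uniformly in `μ ∈ (0, 1)`. -/
def IsLipConstGradH (C : ℝ≥0) : Prop :=
  ∀ μ ∈ Ioo (0 : ℝ) 1, LipschitzOnWith C (fun z => μ • P.gradH z μ) P.box

/-- `(1/N) ∑_n ∑_i max {-x_{n,i}, 0}`; it vanishes for nonnegative data. -/
def negPart : ℝ := 1 / N * ∑ n, ∑ i, max (-P.X i n) 0

/-- The objective of the quadratic program solved at `z` with parameters `μ` and `L`. -/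
def subproblem (z : Var N₀ N₁ N) (μ L : ℝ) (y : Var N₀ N₁ N) : ℝ :=
  inner ℝ (P.gradH z μ) (y - z) + P.regularizer y + L / 2 * ‖y - z‖ ^ 2

/-- The test that decides whether the parameters are kept. -/
def SufficientDecrease (τ₂ : ℝ) (z z' : Var N₀ N₁ N) (μ L : ℝ) : Prop :=
  P.smoothObjective z' μ - P.smoothObjective z μ < -τ₂ * (μ / L)

/-- `(z, μ, L)` are the (infinite) sequences generated by the smoothing proximal gradient
algorithm with parameters `τ₁`, `τ₂`, `τ₃`. -/
structure IsSPG (τ₁ τ₂ τ₃ : ℝ) (z : ℕ → Var N₀ N₁ N) (μ L : ℕ → ℝ) : Prop where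
  z_zero : z 0 ∈ P.feasible
  μ_zero : μ 0 ∈ Ioo (0 : ℝ) 1
  L_zero : 1 ≤ L 0
  τ₁_mem : τ₁ ∈ Ioo (0 : ℝ) 1
  τ₂_pos : 0 < τ₂
  τ₃_ge : 1 ≤ τ₃
  step_mem : ∀ k, z (k + 1) ∈ P.feasible
  step_min : ∀ k, IsMinOn (P.subproblem (z k) (μ k) (L k)) P.feasible (z (k + 1))
  keep : ∀ k, P.SufficientDecrease τ₂ (z k) (z (k + 1)) (μ k) (L k) →
    μ (k + 1) = μ k ∧ L (k + 1) = L k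
  shrink : ∀ k, ¬ P.SufficientDecrease τ₂ (z k) (z (k + 1)) (μ k) (L k) →
    μ (k + 1) = τ₁ * μ k ∧ L (k + 1) = τ₃ * L k

end Model

/-- `p` is an accumulation point of the sequence `(z k)` restricted to the indices `k ∈ K`:
the limit of a subsequence with indices in `K`. -/
def IsAccumulationPoint {E : Type*} [TopologicalSpace E] (z : ℕ → E) (K : Set ℕ) (p : E) : Prop :=
  ∃ φ : ℕ → ℕ, StrictMono φ ∧ (∀ j, φ j ∈ K) ∧ Tendsto (fun j => z (φ j)) atTop (𝓝 p)

end Autoencoder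

end

/-!
The smoothing `smoothRelu y μ` is the average of the shifts `relu (y - μ u)` over `0 ≤ u ≤ 1`
(`smoothRelu_eq_integral`), and also a difference quotient of the continuously differentiable
function `relu ^ 2 / 2` (`smoothRelu_eq_relu_sq`). Each ReLU argument of the model contains a bias
with coefficient one, so that smoothing the nonsmooth part of the objective means averaging its
shifts along one fixed direction (`Model.smoothKink_eq_integral`). Averaging preserves bounds on
difference quotients, hence the derivatives of the smoothing at `z` near `p`, for small `μ`, obey
every bound that the difference quotients of the nonsmooth part obey near `p`
(`fderiv_average_shift_le`). This one-sided consistency holds for the whole sum at once, even though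
the Clarke subdifferential has no exact sum rule here.

As `μ` decreases, the smoothed objective plus `μ * negPart` decreases, to the objective at `μ = 0`.
An iterate at which this quantity is below `θ` lies in the interior of the level set, where the
entries of `W` and `V` are at most `η`; the first-order optimality of the next iterate, with the
Lipschitz constant of the smoothing along feasible directions, bounds the step by `η`
(`Model.norm_step_le`). Both iterates are then in the box on which the gradient is Lipschitz, and
the smoothed objective descends by `(L - LgradH / μ) ‖z' - z‖²`
(`Model.smoothObjective_step_le`). So the bound by `θ` propagates (`Model.IsSPG.invariant`).

When the decrease test fails, the descent is at most `τ₂ μ / L`, and since `LgradH / μ` takes up at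
most a fixed fraction of `L`, it follows that `(L ‖z' - z‖)²` is at most a multiple of `μ`. Along
those indices `μ`, and hence `L ‖z' - z‖`, tends to zero. The gradients of the smoothing are
bounded, a subsequence of them converges, and the optimality conditions of the subproblems become
a variational inequality at the accumulation point; it passes to the tangent cone by scaling. Were
the generalized directional derivative negative in a tangent direction, the consistency above would
contradict this inequality (`Model.clarkeDeriv_objective_nonneg`).
-/

namespace Autoencoder

/-! ### The ReLU and its smoothing -/

lemma relu_nonneg (y : ℝ) : 0 ≤ relu y := le_max_left _ _

lemma continuous_relu : Continuous relu := continuous_const.max continuous_id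

lemma locallyLipschitz_relu : LocallyLipschitz relu :=
  LocallyLipschitz.id.const_max 0

lemma relu_sub_le {a b : ℝ} (hab : a ≤ b) : 0 ≤ relu b - relu a ∧ relu b - relu a ≤ b - a := by
  unfold relu
  constructor
  · linarith [max_le_max (le_refl (0 : ℝ)) hab]
  · rcases max_cases 0 a with h | h <;> rcases max_cases 0 b with h' | h' <;> linarith

/-- The square of the ReLU is differentiable, also at the kink of the ReLU. -/
lemma hasDerivAt_relu_sq (y : ℝ) : HasDerivAt (fun y => relu y ^ 2) (2 * relu y) y := by
  rcases lt_trichotomy y 0 with hy | rfl | hy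
  · have h : (fun y => relu y ^ 2) =ᶠ[𝓝 y] fun _ => 0 := by
      filter_upwards [gt_mem_nhds hy] with x hx
      simp [relu, hx.le]
    rw [show 2 * relu y = 0 by simp [relu, hy.le]]
    exact (hasDerivAt_const y (0 : ℝ)).congr_of_eventuallyEq h
  · rw [hasDerivAt_iff_isLittleO_nhds_zero]
    have h : (fun h : ℝ => relu (0 + h) ^ 2 - relu 0 ^ 2 - h • (2 * relu 0))
        =O[𝓝 0] fun h => h ^ 2 := by
      refine Asymptotics.IsBigO.of_bound 1 (Eventually.of_forall fun h => ?_)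
      rcases max_cases 0 h with h' | h' <;> simp [relu, h'.1, sq_nonneg]
    exact h.trans_isLittleO (by simpa using Asymptotics.isLittleO_pow_id (𝕜 := ℝ) one_lt_two)
  · have h : (fun y => relu y ^ 2) =ᶠ[𝓝 y] fun x => x ^ 2 := by
      filter_upwards [lt_mem_nhds hy] with x hx
      simp [relu, hx.le]
    rw [show 2 * relu y = 2 * y by simp [relu, hy.le]]
    simpa using (hasDerivAt_pow 2 y).congr_of_eventuallyEq h

lemma contDiff_relu_sq : ContDiff ℝ 1 fun y => relu y ^ 2 := by
  refine contDiff_one_iff_deriv.2 ⟨fun y => (hasDerivAt_relu_sq y).differentiableAt, ?_⟩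
  rw [show deriv (fun y => relu y ^ 2) = fun y => 2 * relu y from
    funext fun y => (hasDerivAt_relu_sq y).deriv]
  exact continuous_const.mul continuous_relu

/-- The smoothing of the ReLU is a difference quotient of the primitive `y₊² / 2` of the ReLU. -/
lemma smoothRelu_eq_relu_sq {μ : ℝ} (hμ : 0 < μ) (y : ℝ) :
    smoothRelu y μ = (relu y ^ 2 - relu (y - μ) ^ 2) / (2 * μ) := by
  unfold smoothRelu relu
  split_ifs with h₁ h₂
  · rw [max_eq_left h₁.le, max_eq_left (by linarith)]; simp
  · rw [max_eq_right (not_lt.1 h₁), max_eq_left (by linarith)]; simp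
  · push Not at h₁ h₂
    rw [max_eq_right h₁, max_eq_right (by linarith)]
    field_simp
    ring

/-- The smoothing of the ReLU averages the shifts of the ReLU by `μ u`, `0 ≤ u ≤ 1`. For `μ = 0`
this says that `smoothRelu y 0` is the ReLU itself. -/
lemma smoothRelu_eq_integral {μ : ℝ} (hμ : 0 ≤ μ) (y : ℝ) :
    smoothRelu y μ = ∫ u in (0 : ℝ)..1, relu (y - μ * u) := by
  rcases hμ.eq_or_lt with rfl | hμ
  · simp only [smoothRelu, relu, zero_mul, sub_zero, intervalIntegral.integral_const]
    split_ifs with h₁ h₂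
    · simp [h₁.le]
    · simp [h₂]
    · simp [(not_le.1 h₂).le]
  · have hd : ∀ u ∈ uIcc (0 : ℝ) 1,
        HasDerivAt (fun u => -(relu (y - μ * u) ^ 2) / (2 * μ)) (relu (y - μ * u)) u := by
      intro u _
      have h := (hasDerivAt_relu_sq (y - μ * u)).comp u
        (((hasDerivAt_id u).const_mul μ).const_sub y)
      refine (h.neg.div_const (2 * μ)).congr_deriv ?_
      field_simp
    rw [intervalIntegral.integral_eq_sub_of_hasDerivAt hd
      ((continuous_relu.comp (by fun_prop)).intervalIntegrable _ _), smoothRelu_eq_relu_sq hμ]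
    simp only [mul_one, mul_zero, sub_zero]
    ring

lemma smoothRelu_sub_le {μ ν y : ℝ} (hν : 0 ≤ ν) (h : ν ≤ μ) :
    0 ≤ smoothRelu y ν - smoothRelu y μ ∧ smoothRelu y ν - smoothRelu y μ ≤ (μ - ν) / 2 := by
  have hi : ∀ μ : ℝ,
      IntervalIntegrable (fun u => relu (y - μ * u)) MeasureTheory.volume 0 1 := fun μ =>
    (continuous_relu.comp (by fun_prop)).intervalIntegrable _ _
  have hp : ∀ u ∈ Icc (0 : ℝ) 1, y - μ * u ≤ y - ν * u := fun u hu => by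
    linarith [mul_le_mul_of_nonneg_right h hu.1]
  rw [smoothRelu_eq_integral hν, smoothRelu_eq_integral (hν.trans h),
    ← intervalIntegral.integral_sub (hi ν) (hi μ)]
  refine ⟨intervalIntegral.integral_nonneg zero_le_one fun u hu => (relu_sub_le (hp u hu)).1, ?_⟩
  calc ∫ u in (0 : ℝ)..1, (relu (y - ν * u) - relu (y - μ * u))
      ≤ ∫ u in (0 : ℝ)..1, (μ - ν) * u := by
        refine intervalIntegral.integral_mono_on zero_le_one ((hi ν).sub (hi μ))
          (by apply Continuous.intervalIntegrable; fun_prop) fun u hu => ?_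
        linarith [(relu_sub_le (hp u hu)).2]
    _ = (μ - ν) / 2 := by
        rw [intervalIntegral.integral_const_mul, integral_id]; ring

lemma contDiff_smoothRelu {μ : ℝ} (hμ : 0 < μ) : ContDiff ℝ 1 fun y => smoothRelu y μ := by
  simp only [smoothRelu_eq_relu_sq hμ]
  exact (contDiff_relu_sq.sub (contDiff_relu_sq.comp (contDiff_id.sub contDiff_const))).div_const _

/-! ### Generalized directional derivatives and averages of shifts -/

section Nonsmooth

variable {E : Type*} [NormedAddCommGroup E] [NormedSpace ℝ E]

/-- A bound on the difference quotients of `h` near `p` passes to the derivative of an average of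
shifts of `h`, because averaging preserves the bound. This is the consistency of the gradients of
the smoothing with the generalized directional derivatives of `h`. -/
lemma fderiv_average_shift_le {h : E → ℝ} (hc : Continuous h) {e p z d : E} {δ C μ : ℝ}
    (hδ : 0 < δ)
    (hC : ∀ y ∈ Metric.ball p δ, ∀ t ∈ Ioo 0 δ, h (y + t • d) - h y ≤ C * t)
    (hμ : 0 ≤ μ) (hz : ‖z - p‖ + μ * ‖e‖ < δ) {f' : E →L[ℝ] ℝ}
    (hf : HasFDerivAt (fun y => ∫ u in (0 : ℝ)..1, h (y - (μ * u) • e)) f' z) :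
    f' d ≤ C := by
  have hi : ∀ y : E, IntervalIntegrable (fun u : ℝ => h (y - (μ * u) • e))
      MeasureTheory.volume 0 1 := fun y => (hc.comp (by fun_prop)).intervalIntegrable _ _
  refine le_of_tendsto (hf.hasLineDerivAt d).tendsto_slope_zero_right ?_
  filter_upwards [Ioo_mem_nhdsGT hδ] with t ht
  have key : (∫ u in (0 : ℝ)..1, h (z + t • d - (μ * u) • e))
      - (∫ u in (0 : ℝ)..1, h (z - (μ * u) • e)) ≤ C * t := by
    rw [← intervalIntegral.integral_sub (hi _) (hi _)]
    calc _ ≤ ∫ u in (0 : ℝ)..1, C * t := by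
          refine intervalIntegral.integral_mono_on zero_le_one ((hi _).sub (hi _))
            (by simp) fun u hu => ?_
          rw [show z + t • d - (μ * u) • e = z - (μ * u) • e + t • d by abel]
          refine hC _ ?_ t ht
          rw [Metric.mem_ball, dist_eq_norm,
            show z - (μ * u) • e - p = (z - p) - (μ * u) • e by abel]
          have h₁ : ‖(μ * u) • e‖ ≤ μ * ‖e‖ := by
            rw [norm_smul, Real.norm_of_nonneg (mul_nonneg hμ hu.1)]
            exact mul_le_mul_of_nonneg_right (mul_le_of_le_one_right hμ hu.2) (norm_nonneg _)
          linarith [norm_sub_le (z - p) ((μ * u) • e)]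
      _ = C * t := by simp
  rw [smul_eq_mul, inv_mul_le_iff₀ ht.1]
  linarith

/-- If `f°(p; d) < 0`, then the difference quotients of `f` in the direction `d` near `p` are
bounded by a negative number. -/
lemma exists_forall_sub_le_of_clarkeDeriv_neg {f : E → ℝ} {p d : E} (h : clarkeDeriv f p d < 0) :
    ∃ c < (0 : ℝ), ∃ δ > 0, ∀ y ∈ Metric.ball p δ, ∀ t ∈ Ioo 0 δ, f (y + t • d) - f y ≤ c * t := by
  obtain ⟨c, hc, hc0⟩ := EReal.lt_iff_exists_real_btwn.1 h
  refine ⟨c, by exact_mod_cast hc0, ?_⟩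
  have hev := eventually_lt_of_limsup_lt hc
  obtain ⟨s, hs, t, ht, hst⟩ := mem_prod_iff.1 hev
  obtain ⟨δ₁, hδ₁, h₁⟩ := Metric.mem_nhds_iff.1 hs
  obtain ⟨δ₂, hδ₂, h₂⟩ := mem_nhdsGT_iff_exists_Ioo_subset.1 ht
  refine ⟨min δ₁ δ₂, lt_min hδ₁ hδ₂, fun y hy τ hτ => ?_⟩
  have := hst (mk_mem_prod (h₁ (Metric.ball_subset_ball (min_le_left _ _) hy))
    (h₂ ⟨hτ.1, hτ.2.trans_le (min_le_right _ _)⟩))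
  simp only [mem_ofPred_eq, EReal.coe_lt_coe_iff] at this
  exact ((div_lt_iff₀ hτ.1).1 this).le

/-- A strictly differentiable function has difference quotients close to its derivative. -/
lemma exists_forall_abs_sub_le_of_hasStrictFDerivAt {f : E → ℝ} {f' : E →L[ℝ] ℝ} {p : E}
    (hf : HasStrictFDerivAt f f' p) (d : E) {ε : ℝ} (hε : 0 < ε) :
    ∃ δ > 0, ∀ y ∈ Metric.ball p δ, ∀ t ∈ Ioo 0 δ, |f (y + t • d) - f y - t * f' d| ≤ ε * t := by
  have hd : 0 < ‖d‖ + 1 := by positivity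
  obtain ⟨r, hr, h⟩ := Metric.eventually_nhds_iff_ball.1
    (hf.isLittleO.bound (div_pos hε hd))
  refine ⟨r / 2 / (‖d‖ + 1), by positivity, fun y hy t ht => ?_⟩
  have hle : r / 2 / (‖d‖ + 1) ≤ r / 2 := div_le_self (by positivity) (by linarith [norm_nonneg d])
  rw [mem_ball_iff_norm] at hy
  have htd : ‖t • d‖ ≤ r / 2 := by
    have := (lt_div_iff₀ hd).1 ht.2
    rw [norm_smul, Real.norm_of_nonneg ht.1.le]
    nlinarith [ht.1]
  have hmem : ((y + t • d, y) : E × E) ∈ Metric.ball (p, p) r := by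
    rw [mem_ball_iff_norm]
    change max ‖y + t • d - p‖ ‖y - p‖ < r
    refine max_lt_iff.2 ⟨?_, by linarith⟩
    rw [show y + t • d - p = y - p + t • d by abel]
    linarith [norm_add_le (y - p) (t • d)]
  have := h _ hmem
  simp only [add_sub_cancel_left, map_smul, smul_eq_mul, Real.norm_eq_abs] at this
  refine this.trans ?_
  rw [norm_smul, Real.norm_of_nonneg ht.1.le, div_mul_eq_mul_div, div_le_iff₀ hd]
  nlinarith [mul_pos hε ht.1]

end Nonsmooth

/-! ### The objective and its smoothing -/

namespace Model

variable {N₀ N₁ N : ℕ} (P : Model N₀ N₁ N)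

lemma contDiff_aux (n : Fin N) (j : Fin N₁) :
    ContDiff ℝ 1 fun z : Var N₀ N₁ N => aux z n j := by
  unfold aux; fun_prop

lemma contDiff_pre₁ (n : Fin N) (j : Fin N₁) : ContDiff ℝ 1 fun z => P.pre₁ z n j := by
  unfold pre₁ wt bias₁; fun_prop

lemma contDiff_pre₂ (n : Fin N) (i : Fin N₀) : ContDiff ℝ 1 fun z => P.pre₂ z n i := by
  unfold pre₂ wt aux bias₂; fun_prop

lemma contDiff_regularizer : ContDiff ℝ 1 P.regularizer := by
  unfold regularizer wt aux; fun_prop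

/-- The continuously differentiable part of `𝓕 + 𝓟`, which the smoothing leaves alone. -/
noncomputable def smoothPart (z : Var N₀ N₁ N) : ℝ :=
  1 / N * (∑ n, ∑ i, relu (P.pre₂ z n i) ^ 2) + 1 / N * P.normXFsq + P.β * ∑ n, ∑ j, aux z n j

/-- The nonsmooth part of `𝓕 + 𝓟`, a linear combination of ReLUs. -/
noncomputable def kinkPart (z : Var N₀ N₁ N) : ℝ :=
  -(2 / N * ∑ n, ∑ i, P.X i n * relu (P.pre₂ z n i)) - P.β * ∑ n, ∑ j, relu (P.pre₁ z n j)

/-- The smoothing of `kinkPart`. -/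
noncomputable def smoothKink (z : Var N₀ N₁ N) (μ : ℝ) : ℝ :=
  -(2 / N * ∑ n, ∑ i, P.X i n * smoothRelu (P.pre₂ z n i) μ)
    - P.β * ∑ n, ∑ j, smoothRelu (P.pre₁ z n j) μ

/-- The direction in which all biases grow at unit rate. -/
noncomputable def biasDir (N₀ N₁ N : ℕ) : Var N₀ N₁ N :=
  WithLp.toLp 2 (Sum.elim 0 (Sum.elim 1 0))

lemma pre₁_sub_smul_biasDir (z : Var N₀ N₁ N) (n : Fin N) (j : Fin N₁) (s : ℝ) :
    P.pre₁ (z - s • biasDir N₀ N₁ N) n j = P.pre₁ z n j - s := by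
  cases j
  simp [pre₁, wt, bias₁, biasDir]
  ring

lemma pre₂_sub_smul_biasDir (z : Var N₀ N₁ N) (n : Fin N) (i : Fin N₀) (s : ℝ) :
    P.pre₂ (z - s • biasDir N₀ N₁ N) n i = P.pre₂ z n i - s := by
  simp [pre₂, wt, bias₂, aux, biasDir]
  ring

lemma continuous_kinkPart : Continuous P.kinkPart := by
  have h₁ := fun n j => continuous_relu.comp (P.contDiff_pre₁ n j).continuous
  have h₂ := fun n i => continuous_relu.comp (P.contDiff_pre₂ n i).continuous
  simp only [Function.comp_def] at h₁ h₂
  unfold kinkPart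
  fun_prop

lemma locallyLipschitz_kinkPart : LocallyLipschitz P.kinkPart := by
  have hsum : ∀ {ι : Type} (s : Finset ι) (f : ι → Var N₀ N₁ N → ℝ),
      (∀ i, LocallyLipschitz (f i)) → LocallyLipschitz fun z => ∑ i ∈ s, f i z := by
    intro ι s f hf
    classical
    induction s using Finset.induction_on with
    | empty => simpa using LocallyLipschitz.const (0 : ℝ)
    | insert a s ha ih => simpa [Finset.sum_insert ha] using (hf a).add ih
  have hmul : ∀ (c : ℝ) (f : Var N₀ N₁ N → ℝ), LocallyLipschitz f →
      LocallyLipschitz fun z => c * f z := fun c f hf =>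
    (contDiff_const.mul contDiff_id : ContDiff ℝ 1 fun x : ℝ => c * x).locallyLipschitz.comp hf
  refine ((hmul _ _ (hsum _ _ fun n => hsum _ _ fun i => hmul _ _ ?_)).neg).sub
    (hmul _ _ (hsum _ _ fun n => hsum _ _ fun j => ?_))
  · exact locallyLipschitz_relu.comp (P.contDiff_pre₂ n i).locallyLipschitz
  · exact locallyLipschitz_relu.comp (P.contDiff_pre₁ n j).locallyLipschitz

/-- Since every ReLU argument contains a bias with coefficient one, smoothing all ReLUs amounts to
averaging the shifts of `kinkPart` along the single direction `biasDir`. -/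
lemma smoothKink_eq_integral {μ : ℝ} (hμ : 0 ≤ μ) (z : Var N₀ N₁ N) :
    P.smoothKink z μ = ∫ u in (0 : ℝ)..1, P.kinkPart (z - (μ * u) • biasDir N₀ N₁ N) := by
  have hc : ∀ c y : ℝ, Continuous fun u => c * relu (y - μ * u) := fun c y =>
    (continuous_relu.comp (by fun_prop)).const_mul c
  have hc' : ∀ y : ℝ, Continuous fun u => relu (y - μ * u) := fun y =>
    continuous_relu.comp (by fun_prop)
  have h₁ : ∫ u in (0 : ℝ)..1, ∑ n, ∑ j, relu (P.pre₁ z n j - μ * u)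
      = ∑ n, ∑ j, smoothRelu (P.pre₁ z n j) μ := by
    rw [intervalIntegral.integral_finsetSum]
    · refine Finset.sum_congr rfl fun n _ => ?_
      rw [intervalIntegral.integral_finsetSum fun j _ => (hc' _).intervalIntegrable _ _]
      simp_rw [smoothRelu_eq_integral hμ]
    · exact fun n _ => Continuous.intervalIntegrable (by fun_prop) _ _
  have h₂ : ∫ u in (0 : ℝ)..1, ∑ n, ∑ i, P.X i n * relu (P.pre₂ z n i - μ * u)
      = ∑ n, ∑ i, P.X i n * smoothRelu (P.pre₂ z n i) μ := by
    rw [intervalIntegral.integral_finsetSum]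
    · refine Finset.sum_congr rfl fun n _ => ?_
      rw [intervalIntegral.integral_finsetSum fun i _ => (hc _ _).intervalIntegrable _ _]
      simp_rw [smoothRelu_eq_integral hμ, intervalIntegral.integral_const_mul]
    · exact fun n _ => Continuous.intervalIntegrable (by fun_prop) _ _
  simp only [kinkPart, pre₁_sub_smul_biasDir, pre₂_sub_smul_biasDir]
  rw [intervalIntegral.integral_sub, intervalIntegral.integral_neg,
    intervalIntegral.integral_const_mul, intervalIntegral.integral_const_mul, h₁, h₂, smoothKink]
  all_goals apply Continuous.intervalIntegrable; fun_prop

lemma smoothH_eq (z : Var N₀ N₁ N) (μ : ℝ) :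
    P.smoothH z μ = P.smoothPart z + P.smoothKink z μ := by
  simp only [smoothH, smoothFidelity, smoothPenalty, smoothPart, smoothKink,
    Finset.sum_sub_distrib]
  ring

lemma objective_eq (z : Var N₀ N₁ N) :
    P.objective z = P.smoothPart z + P.kinkPart z + P.regularizer z := by
  simp only [objective, fidelity, penalty, smoothPart, kinkPart, normXFsq, sub_sq,
    Finset.sum_sub_distrib, Finset.sum_add_distrib]
  have : ∑ n, ∑ i, 2 * relu (P.pre₂ z n i) * P.X i n
      = 2 * ∑ n, ∑ i, P.X i n * relu (P.pre₂ z n i) := by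
    simp only [Finset.mul_sum]
    exact Finset.sum_congr rfl fun _ _ => Finset.sum_congr rfl fun _ _ => by ring
  rw [this]
  ring

lemma smoothObjective_zero (z : Var N₀ N₁ N) : P.smoothObjective z 0 = P.objective z := by
  rw [smoothObjective, smoothH_eq, objective_eq, P.smoothKink_eq_integral le_rfl]
  simp

lemma contDiff_smoothPart : ContDiff ℝ 1 P.smoothPart := by
  have h := fun n i => contDiff_relu_sq.comp (P.contDiff_pre₂ n i)
  have h' := fun n j => contDiff_aux (N₀ := N₀) (N₁ := N₁) (N := N) n j
  simp only [Function.comp_def] at h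
  unfold smoothPart
  fun_prop

lemma contDiff_smoothKink {μ : ℝ} (hμ : 0 < μ) : ContDiff ℝ 1 fun z => P.smoothKink z μ := by
  have h₁ := fun n j => (contDiff_smoothRelu hμ).comp (P.contDiff_pre₁ n j)
  have h₂ := fun n i => (contDiff_smoothRelu hμ).comp (P.contDiff_pre₂ n i)
  simp only [Function.comp_def] at h₁ h₂
  unfold smoothKink
  fun_prop

lemma contDiff_smoothH {μ : ℝ} (hμ : 0 < μ) : ContDiff ℝ 1 fun z => P.smoothH z μ := by
  simp only [smoothH_eq]
  exact P.contDiff_smoothPart.add (P.contDiff_smoothKink hμ)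

lemma continuous_objective : Continuous P.objective := by
  rw [show P.objective = fun z => P.smoothPart z + P.kinkPart z + P.regularizer z from
    funext P.objective_eq]
  exact (P.contDiff_smoothPart.continuous.add P.continuous_kinkPart).add
    P.contDiff_regularizer.continuous

lemma hasFDerivAt_smoothH {μ : ℝ} (hμ : 0 < μ) (z : Var N₀ N₁ N) :
    HasFDerivAt (fun y => P.smoothH y μ) (innerSL ℝ (P.gradH z μ)) z :=
  ((P.contDiff_smoothH hμ).differentiable one_ne_zero z).hasGradientAt.hasFDerivAt

/-- The smoothing error of the ReLUs with a positive weight in the objective is compensated by the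
term `μ * negPart`; the other errors have the right sign. -/
lemma smoothObjective_add_le (hβ : 0 ≤ P.β) {μ ν : ℝ} (hν : 0 ≤ ν) (h : ν ≤ μ)
    (z : Var N₀ N₁ N) :
    P.smoothObjective z ν + ν * P.negPart ≤ P.smoothObjective z μ + μ * P.negPart := by
  -- Only the entries with `X i n < 0` let the sum grow, each by at most `-X i n * (μ - ν) / 2`.
  have h₁ : ∑ n, ∑ i, P.X i n * smoothRelu (P.pre₂ z n i) μ
      ≤ ∑ n, ∑ i, P.X i n * smoothRelu (P.pre₂ z n i) ν
        + (μ - ν) / 2 * ∑ n, ∑ i, max (-P.X i n) 0 := by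
    simp only [Finset.mul_sum, ← Finset.sum_add_distrib]
    refine Finset.sum_le_sum fun n _ => Finset.sum_le_sum fun i _ => ?_
    obtain ⟨ha, hb⟩ := smoothRelu_sub_le (y := P.pre₂ z n i) hν h
    nlinarith [mul_le_mul_of_nonneg_right (le_max_left (-P.X i n) 0) ha,
      mul_le_mul_of_nonneg_left hb (le_max_right (-P.X i n) 0)]
  have h₂ : ∑ n, ∑ j, smoothRelu (P.pre₁ z n j) μ ≤ ∑ n, ∑ j, smoothRelu (P.pre₁ z n j) ν :=
    Finset.sum_le_sum fun n _ => Finset.sum_le_sum fun j _ =>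
      sub_nonneg.1 (smoothRelu_sub_le hν h).1
  have h₃ := mul_le_mul_of_nonneg_left h₁ (by positivity : (0 : ℝ) ≤ 2 / N)
  have h₄ := mul_le_mul_of_nonneg_left h₂ hβ
  simp only [smoothObjective, smoothH_eq, smoothKink, negPart]
  have h₅ : 2 / (N : ℝ) * ((μ - ν) / 2 * ∑ n, ∑ i, max (-P.X i n) 0)
      = μ * (1 / N * ∑ n, ∑ i, max (-P.X i n) 0) - ν * (1 / N * ∑ n, ∑ i, max (-P.X i n) 0) := by
    ring
  rw [mul_add, h₅] at h₃
  linarith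

lemma objective_le_smoothObjective_add (hβ : 0 ≤ P.β) {μ : ℝ} (hμ : 0 ≤ μ) (z : Var N₀ N₁ N) :
    P.objective z ≤ P.smoothObjective z μ + μ * P.negPart := by
  simpa [smoothObjective_zero] using P.smoothObjective_add_le hβ le_rfl hμ z

/-! ### The regularizer and the feasible set -/

/-- The derivative of the regularizer at `z` in the direction `v`. -/
noncomputable def regDeriv (z v : Var N₀ N₁ N) : ℝ :=
  P.lam₁ * ∑ n, ∑ j, aux v n j + 2 * P.lam₂ * ∑ j, ∑ i, wt z j i * wt v j i

lemma regularizer_add (z v : Var N₀ N₁ N) :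
    P.regularizer (z + v)
      = P.regularizer z + P.regDeriv z v + P.lam₂ * ∑ j, ∑ i, wt v j i ^ 2 := by
  simp only [regularizer, regDeriv, wt, aux, PiLp.add_apply, add_sq, Finset.sum_add_distrib]
  simp only [mul_assoc (2 : ℝ), ← Finset.mul_sum]
  ring

lemma regDeriv_smul (z v : Var N₀ N₁ N) (t : ℝ) : P.regDeriv z (t • v) = t * P.regDeriv z v := by
  simp only [regDeriv, wt, aux, PiLp.smul_apply, smul_eq_mul, mul_left_comm _ t, ← Finset.mul_sum]
  ring

lemma continuous_regDeriv :
    Continuous fun p : Var N₀ N₁ N × Var N₀ N₁ N => P.regDeriv p.1 p.2 := by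
  unfold regDeriv wt aux; fun_prop

lemma fderiv_regularizer_apply (z v : Var N₀ N₁ N) :
    fderiv ℝ P.regularizer z v = P.regDeriv z v := by
  have h := ((P.contDiff_regularizer.differentiable one_ne_zero z).hasFDerivAt.hasLineDerivAt
    v).tendsto_slope_zero_right
  refine tendsto_nhds_unique h ?_
  have h' : Tendsto (fun t : ℝ => P.regDeriv z v + t * (P.lam₂ * ∑ j, ∑ i, wt v j i ^ 2))
      (𝓝[>] 0) (𝓝 (P.regDeriv z v + 0 * (P.lam₂ * ∑ j, ∑ i, wt v j i ^ 2))) :=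
    (Continuous.tendsto (by fun_prop) 0).mono_left nhdsWithin_le_nhds
  rw [zero_mul, add_zero] at h'
  refine h'.congr' ?_
  filter_upwards [self_mem_nhdsWithin] with t ht
  have ht' : t ≠ 0 := ne_of_gt ht
  have hs : ∑ j, ∑ i, wt (t • v) j i ^ 2 = t ^ 2 * ∑ j, ∑ i, wt v j i ^ 2 := by
    simp only [wt, PiLp.smul_apply, smul_eq_mul, mul_pow, ← Finset.mul_sum]
  rw [regularizer_add, regDeriv_smul, hs, smul_eq_mul]
  field_simp
  ring

lemma abs_regDeriv_le (h₁ : 0 ≤ P.lam₁) (h₂ : 0 ≤ P.lam₂) {z : Var N₀ N₁ N} {B : ℝ}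
    (hz : ∀ j i, |wt z j i| ≤ B) (v : Var N₀ N₁ N) :
    |P.regDeriv z v| ≤ (P.lam₁ * N₁ * N + 2 * P.lam₂ * N₁ * N₀ * B) * ‖v‖ := by
  have ha : |∑ n, ∑ j, aux v n j| ≤ N * (N₁ * ‖v‖) := by
    refine (Finset.abs_sum_le_sum_abs _ _).trans ?_
    refine (Finset.sum_le_sum fun n _ => (Finset.abs_sum_le_sum_abs _ _).trans
      (Finset.sum_le_sum fun j _ => PiLp.norm_apply_le v _)).trans_eq ?_
    simp
  have hb : |∑ j, ∑ i, wt z j i * wt v j i| ≤ N₁ * (N₀ * (B * ‖v‖)) := by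
    refine (Finset.abs_sum_le_sum_abs _ _).trans ?_
    refine (Finset.sum_le_sum fun j _ => (Finset.abs_sum_le_sum_abs _ _).trans
      (Finset.sum_le_sum fun i _ => (abs_mul _ _).trans_le (mul_le_mul (hz j i)
        (PiLp.norm_apply_le v _) (abs_nonneg _) ((abs_nonneg _).trans (hz j i))))).trans_eq ?_
    simp
  refine (abs_add_le _ _).trans ?_
  rw [abs_mul, abs_mul, abs_of_nonneg h₁, abs_of_nonneg (by positivity : 0 ≤ 2 * P.lam₂)]
  have := mul_le_mul_of_nonneg_left ha h₁
  have := mul_le_mul_of_nonneg_left hb (by positivity : 0 ≤ 2 * P.lam₂)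
  linarith

lemma convex_feasible : Convex ℝ P.feasible := by
  have hp : ∀ (x y : Var N₀ N₁ N) (a b : ℝ) n j,
      P.pre₁ (a • x + b • y) n j = a * P.pre₁ x n j + b * P.pre₁ y n j := by
    intro x y a b n j
    simp only [pre₁, wt, bias₁, PiLp.add_apply, PiLp.smul_apply, smul_eq_mul, add_mul,
      Finset.sum_add_distrib, mul_assoc, ← Finset.mul_sum]
    ring
  have habs : ∀ {s t a b : ℝ}, 0 ≤ a → 0 ≤ b → a + b = 1 → |s| ≤ P.α → |t| ≤ P.α →
      |a * s + b * t| ≤ P.α := by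
    intro s t a b ha hb hab hs ht
    have := convex_Icc (-P.α) P.α (abs_le.1 hs) (abs_le.1 ht) ha hb hab
    exact abs_le.2 this
  intro x hx y hy a b ha hb hab
  refine ⟨fun n j => ?_, fun j => habs ha hb hab (hx.2.1 j) (hy.2.1 j),
    fun i => habs ha hb hab (hx.2.2 i) (hy.2.2 i)⟩
  have h₁ := mul_le_mul_of_nonneg_left (max_le_iff.1 (hx.1 n j)).1 ha
  have h₂ := mul_le_mul_of_nonneg_left (max_le_iff.1 (hy.1 n j)).1 hb
  have h₃ := mul_le_mul_of_nonneg_left (max_le_iff.1 (hx.1 n j)).2 ha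
  have h₄ := mul_le_mul_of_nonneg_left (max_le_iff.1 (hy.1 n j)).2 hb
  have he : aux (a • x + b • y) n j = a * aux x n j + b * aux y n j := rfl
  rw [he, hp]
  exact max_le (by linarith) (by linarith)

lemma isClosed_feasible : IsClosed P.feasible := by
  have h₂ : P.Ω₂ = ⋂ n, ⋂ j, {z | relu (P.pre₁ z n j) ≤ aux z n j} := by
    ext z; simp [Ω₂]
  have h₃ : P.Ω₃ = (⋂ j, {z | |bias₁ z j| ≤ P.α}) ∩ ⋂ i, {z | |bias₂ z i| ≤ P.α} := by
    ext z; simp [Ω₃]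
  unfold feasible
  rw [h₂, h₃]
  unfold bias₁ bias₂
  refine (isClosed_iInter fun n => isClosed_iInter fun j => isClosed_le ?_ ?_).inter
    ((isClosed_iInter fun j => isClosed_le ?_ continuous_const).inter
      (isClosed_iInter fun i => isClosed_le ?_ continuous_const))
  · exact continuous_relu.comp (P.contDiff_pre₁ n j).continuous
  · exact (contDiff_aux n j).continuous
  · fun_prop
  · fun_prop

lemma convex_box : Convex ℝ P.box := by
  intro x hx y hy a b ha hb hab i
  have := convex_Icc (-max P.α (2 * P.η)) (max P.α (2 * P.η)) (abs_le.1 (hx i)) (abs_le.1 (hy i))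
    ha hb hab
  exact abs_le.2 this

lemma eta_pos (h₁ : 0 < P.lam₁) (hθ : 0 < P.θ) : 0 < P.η :=
  lt_max_of_lt_right (div_pos hθ h₁)

/-- On the level set the regularizer is at most `θ`, which bounds the entries of `W` and `V`. -/
lemma abs_le_eta (hN₀ : 0 < N₀) (hN₁ : 0 < N₁) (h₁ : 0 < P.lam₁) (h₂ : 0 < P.lam₂) (hβ : 0 ≤ P.β)
    {z : Var N₀ N₁ N} (hz : z ∈ P.levelSet) :
    (∀ j i, |wt z j i| ≤ P.η) ∧ ∀ n j, |aux z n j| ≤ P.η := by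
  obtain ⟨hz, hobj⟩ := hz
  have hv : ∀ n j, 0 ≤ aux z n j := fun n j => (relu_nonneg _).trans (hz n j)
  have hF : 0 ≤ P.fidelity z := by unfold fidelity; positivity
  have hP : 0 ≤ P.penalty z := mul_nonneg hβ (Finset.sum_nonneg fun n _ =>
    Finset.sum_nonneg fun j _ => sub_nonneg.2 (hz n j))
  have hV : 0 ≤ ∑ n, ∑ j, aux z n j :=
    Finset.sum_nonneg fun n _ => Finset.sum_nonneg fun j _ => hv n j
  have hW : 0 ≤ ∑ j, ∑ i, wt z j i ^ 2 := by positivity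
  have hR : P.lam₁ * ∑ n, ∑ j, aux z n j + P.lam₂ * ∑ j, ∑ i, wt z j i ^ 2 ≤ P.θ := by
    unfold objective regularizer at hobj; linarith
  have hθ : 0 ≤ P.θ := hR.trans' (by positivity)
  constructor
  · intro j i
    refine (Real.abs_le_sqrt ?_).trans (le_max_left _ _)
    have hs : wt z j i ^ 2 ≤ ∑ j, ∑ i, wt z j i ^ 2 :=
      (Finset.single_le_sum (f := fun i => wt z j i ^ 2) (fun _ _ => sq_nonneg _)
        (Finset.mem_univ i)).trans (Finset.single_le_sum (f := fun j => ∑ i, wt z j i ^ 2)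
        (fun _ _ => Finset.sum_nonneg fun _ _ => sq_nonneg _) (Finset.mem_univ j))
    rw [le_div_iff₀ h₂]
    have h₃ : (1 : ℝ) ≤ N₁ * N₀ := by exact_mod_cast Nat.mul_pos hN₁ hN₀
    nlinarith [mul_nonneg h₁.le hV, mul_le_mul_of_nonneg_right hs h₂.le,
      mul_le_mul_of_nonneg_right h₃ hθ]
  · intro n j
    rw [abs_of_nonneg (hv n j)]
    refine le_trans ?_ (le_max_right _ _)
    have hs : aux z n j ≤ ∑ n, ∑ j, aux z n j :=
      (Finset.single_le_sum (f := fun j => aux z n j) (fun j _ => hv n j)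
        (Finset.mem_univ j)).trans (Finset.single_le_sum (f := fun n => ∑ j, aux z n j)
        (fun n _ => Finset.sum_nonneg fun j _ => hv n j) (Finset.mem_univ n))
    rw [le_div_iff₀ h₁]
    nlinarith [mul_nonneg h₂.le hW, mul_le_mul_of_nonneg_right hs h₁.le]

lemma mem_box_of_forall {z : Var N₀ N₁ N} (hz : z ∈ P.feasible)
    (hW : ∀ j i, |wt z j i| ≤ 2 * P.η) (hV : ∀ n j, |aux z n j| ≤ 2 * P.η) : z ∈ P.box := by
  rintro (⟨j, i⟩ | (j | i) | ⟨j, n⟩)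
  · exact (hW j i).trans (le_max_right _ _)
  · exact (hz.2.1 j).trans (le_max_left _ _)
  · exact (hz.2.2 i).trans (le_max_left _ _)
  · exact (hV n j).trans (le_max_right _ _)

lemma isBounded_box : Bornology.IsBounded P.box := by
  rw [isBounded_iff_forall_norm_le]
  refine ⟨√(∑ _i : Idx N₀ N₁ N, max P.α (2 * P.η) ^ 2), fun z hz => ?_⟩
  rw [EuclideanSpace.norm_eq]
  exact Real.sqrt_le_sqrt (Finset.sum_le_sum fun i _ =>
    pow_le_pow_left₀ (norm_nonneg _) (hz i) 2)

/-! ### One step of the algorithm -/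

section Step

variable {z z' : Var N₀ N₁ N} {μ L : ℝ}

/-- The first-order optimality condition of the convex quadratic program. -/
lemma variational_of_isMinOn (hz' : z' ∈ P.feasible)
    (hmin : IsMinOn (P.subproblem z μ L) P.feasible z') {y : Var N₀ N₁ N} (hy : y ∈ P.feasible) :
    0 ≤ inner ℝ (P.gradH z μ) (y - z') + P.regDeriv z' (y - z')
      + inner ℝ (L • (z' - z)) (y - z') := by
  set w := y - z'
  set a := inner ℝ (P.gradH z μ) w + P.regDeriv z' w + inner ℝ (L • (z' - z)) w with ha
  set b := P.lam₂ * (∑ j, ∑ i, wt w j i ^ 2) + L / 2 * ‖w‖ ^ 2 with hb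
  have hlim : Tendsto (fun t : ℝ => a + t * b) (𝓝[>] 0) (𝓝 (a + 0 * b)) :=
    (Continuous.tendsto (by fun_prop) 0).mono_left nhdsWithin_le_nhds
  rw [zero_mul, add_zero] at hlim
  refine ge_of_tendsto hlim ?_
  filter_upwards [Ioo_mem_nhdsGT one_pos] with t ht
  have hmem : z' + t • w ∈ P.feasible :=
    P.convex_feasible.add_smul_sub_mem hz' hy ⟨ht.1.le, ht.2.le⟩
  have hle : P.subproblem z μ L z' ≤ P.subproblem z μ L (z' + t • w) := hmin hmem
  have hs : ∑ j, ∑ i, wt (t • w) j i ^ 2 = t ^ 2 * ∑ j, ∑ i, wt w j i ^ 2 := by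
    simp only [wt, PiLp.smul_apply, smul_eq_mul, mul_pow, ← Finset.mul_sum]
  have he : P.subproblem z μ L (z' + t • w) = P.subproblem z μ L z' + t * (a + t * b) := by
    simp only [subproblem]
    rw [show z' + t • w - z = (z' - z) + t • w by abel, inner_add_right, norm_add_sq_real,
      regularizer_add, regDeriv_smul, hs, norm_smul, ha, hb]
    simp only [inner_smul_right, inner_smul_left, mul_pow, Real.norm_eq_abs, sq_abs,
      RCLike.conj_to_real]
    ring
  have : 0 ≤ t * (a + t * b) := by linarith
  exact nonneg_of_mul_nonneg_right this ht.1

/-- The first-order model decreases by a full `L ‖z' - z‖²`, twice what comparing values of the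
quadratic program gives, by its strong convexity. -/
lemma model_decrease_of_isMinOn (h₂ : 0 ≤ P.lam₂) (hz : z ∈ P.feasible) (hz' : z' ∈ P.feasible)
    (hmin : IsMinOn (P.subproblem z μ L) P.feasible z') :
    inner ℝ (P.gradH z μ) (z' - z) + P.regularizer z' - P.regularizer z + L * ‖z' - z‖ ^ 2 ≤ 0 := by
  have h := P.variational_of_isMinOn hz' hmin hz
  have hr := P.regularizer_add z' (z - z')
  rw [add_sub_cancel] at hr
  have hQ : 0 ≤ P.lam₂ * ∑ j, ∑ i, wt (z - z') j i ^ 2 := by positivity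
  rw [show z - z' = -(z' - z) by abel] at h hr hQ
  rw [inner_neg_right, inner_neg_right, inner_smul_left, real_inner_self_eq_norm_sq] at h
  simp only [RCLike.conj_to_real] at h
  linarith

/-- A Lipschitz constant of `μ 𝓗̃` on the level set bounds the slope of `𝓗̃` in every feasible
direction at a point strictly inside the level set. It need not bound the gradient, since the
feasible set may have that point on its boundary. -/
lemma neg_inner_gradH_le (hμ : μ ∈ Ioo (0 : ℝ) 1) {LH : ℝ≥0} (hLH : P.IsLipConstH LH)
    (hz : z ∈ P.feasible) (hz' : z' ∈ P.feasible) (hobj : P.objective z < P.θ) :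
    -(μ * inner ℝ (P.gradH z μ) (z' - z)) ≤ LH * ‖z' - z‖ := by
  have hs := ((P.hasFDerivAt_smoothH hμ.1 z).hasLineDerivAt (z' - z)).tendsto_slope_zero_right
  refine le_of_tendsto (hs.const_mul μ).neg ?_
  have hlev : ∀ᶠ t : ℝ in 𝓝[>] 0, P.objective (z + t • (z' - z)) < P.θ := by
    have hc : Continuous fun t : ℝ => P.objective (z + t • (z' - z)) :=
      P.continuous_objective.comp (by fun_prop)
    have := (hc.tendsto 0).eventually_lt_const (u := P.θ) (by simpa using hobj)
    exact this.filter_mono nhdsWithin_le_nhds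
  filter_upwards [hlev, Ioo_mem_nhdsGT one_pos] with t ht₁ ht₂
  have hmem : z + t • (z' - z) ∈ P.feasible :=
    P.convex_feasible.add_smul_sub_mem hz hz' ⟨ht₂.1.le, ht₂.2.le⟩
  have := (hLH μ hμ).dist_le_mul _ ⟨⟨hmem.1, ht₁.le⟩, hmem⟩ _ ⟨⟨hz.1, hobj.le⟩, hz⟩
  rw [dist_eq_norm, dist_eq_norm, add_sub_cancel_left, norm_smul, Real.norm_of_nonneg ht₂.1.le,
    Real.norm_eq_abs] at this
  have h' := (abs_le.1 this).1
  rw [smul_eq_mul, ← mul_assoc, mul_comm μ, mul_assoc, ← mul_neg, inv_mul_le_iff₀ ht₂.1]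
  linarith

/-- Dividing the model decrease by the length of the step bounds that length by the slopes of `𝓗̃`
and of the regularizer, over `L`; the first lower bound on `μ L` makes the quotient at most `η`. -/
lemma norm_step_le (h₁ : 0 < P.lam₁) (h₂ : 0 < P.lam₂) (hβ : 0 ≤ P.β) (hN₀ : 0 < N₀)
    (hN₁ : 0 < N₁) (hθ : 0 < P.θ) (hμ : μ ∈ Ioo (0 : ℝ) 1)
    {LH : ℝ≥0} (hLH : P.IsLipConstH LH)
    (hL : 6 * P.lam₂ * N₁ * N₀
      + 2 / P.η * (((N₀ * N₁ + N₁ + N₀ + N₁ * N : ℕ) : ℝ) * LH + P.lam₁ * N₁ * N) ≤ μ * L)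
    (hz : z ∈ P.feasible) (hz' : z' ∈ P.feasible) (hobj : P.objective z < P.θ)
    (hmin : IsMinOn (P.subproblem z μ L) P.feasible z') : ‖z' - z‖ ≤ P.η := by
  have hη := P.eta_pos h₁ hθ
  have hm := P.model_decrease_of_isMinOn h₂.le hz hz' hmin
  have hi := P.neg_inner_gradH_le hμ hLH hz hz' hobj
  have hr := (abs_le.1 (P.abs_regDeriv_le h₁.le h₂.le
    (P.abs_le_eta hN₀ hN₁ h₁ h₂ hβ ⟨hz.1, hobj.le⟩).1 (z' - z))).1
  have hr' := P.regularizer_add z (z' - z)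
  rw [add_sub_cancel] at hr'
  have hQ : 0 ≤ P.lam₂ * ∑ j, ∑ i, wt (z' - z) j i ^ 2 := by positivity
  set d := ‖z' - z‖
  set c := P.lam₁ * N₁ * N + 2 * P.lam₂ * N₁ * N₀ * P.η
  have hc : 0 ≤ c := by positivity
  rcases (norm_nonneg (z' - z)).eq_or_lt with hd | hd
  · exact (show d = 0 from hd.symm).trans_le hη.le
  have hd' : 0 < d := hd
  have hcd : 0 ≤ c * d := by positivity
  have key : μ * L * d ≤ LH + c := by
    have h₃ : L * d ^ 2 ≤ -inner ℝ (P.gradH z μ) (z' - z) + c * d := by linarith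
    have h₄ := mul_le_mul_of_nonneg_left h₃ hμ.1.le
    have h₅ : μ * (c * d) ≤ c * d := mul_le_of_le_one_left hcd hμ.2.le
    refine le_of_mul_le_mul_right ?_ hd'
    linarith
  have hn : (1 : ℝ) ≤ ((N₀ * N₁ + N₁ + N₀ + N₁ * N : ℕ) : ℝ) := by
    exact_mod_cast (show 1 ≤ N₀ * N₁ + N₁ + N₀ + N₁ * N by omega)
  have hLη : LH + c ≤ μ * L * P.η := by
    have h₆ := mul_le_mul_of_nonneg_right hL hη.le
    rw [add_mul, mul_right_comm (2 / P.η), div_mul_cancel₀ _ hη.ne'] at h₆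
    have h₇ : (LH : ℝ) ≤ ((N₀ * N₁ + N₁ + N₀ + N₁ * N : ℕ) : ℝ) * LH :=
      le_mul_of_one_le_left LH.2 hn
    have h₈ : 0 ≤ P.lam₁ * N₁ * N := by positivity
    have h₉ : 0 ≤ P.lam₂ * N₁ * N₀ * P.η := by positivity
    have h₀ : (0 : ℝ) ≤ LH := LH.2
    simp only [c]
    linarith
  have hpos : 0 < μ * L := by
    refine lt_of_lt_of_le ?_ hL
    have h₃ : (0 : ℝ) < N₁ := by exact_mod_cast hN₁
    have h₄ : (0 : ℝ) < N₀ := by exact_mod_cast hN₀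
    positivity
  exact le_of_mul_le_mul_left (key.trans hLη) hpos

lemma mem_box_of_norm_step_le (hN₀ : 0 < N₀) (hN₁ : 0 < N₁) (h₁ : 0 < P.lam₁) (h₂ : 0 < P.lam₂)
    (hβ : 0 ≤ P.β) (hz : z ∈ P.levelSet) (hz' : z' ∈ P.feasible) (hd : ‖z' - z‖ ≤ P.η) :
    z' ∈ P.box := by
  obtain ⟨hW, hV⟩ := P.abs_le_eta hN₀ hN₁ h₁ h₂ hβ hz
  have hi : ∀ i, |z i| ≤ P.η → |z' i| ≤ 2 * P.η := by
    intro i h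
    have h' : |z' i - z i| ≤ P.η := (PiLp.norm_apply_le (z' - z) i).trans hd
    rw [abs_le] at *
    constructor <;> linarith
  exact P.mem_box_of_forall hz' (fun j i => hi _ (hW j i)) fun n j => hi _ (hV n j)

/-- The descent estimate: the Lipschitz constant of the gradient on the box controls the error of
the first-order model. -/
lemma smoothObjective_step_le (h₂ : 0 ≤ P.lam₂) (hμ : μ ∈ Ioo (0 : ℝ) 1) {LgradH : ℝ≥0}
    (hLg : P.IsLipConstGradH LgradH) (hz : z ∈ P.feasible) (hz' : z' ∈ P.feasible)
    (hb : z ∈ P.box) (hb' : z' ∈ P.box) (hmin : IsMinOn (P.subproblem z μ L) P.feasible z') :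
    P.smoothObjective z' μ + (L - LgradH / μ) * ‖z' - z‖ ^ 2 ≤ P.smoothObjective z μ := by
  have hm := P.model_decrease_of_isMinOn h₂ hz hz' hmin
  have hmv := Convex.norm_image_sub_le_of_norm_hasFDerivWithin_le'
    (f := fun y => P.smoothH y μ) (s := segment ℝ z z') (C := LgradH / μ * ‖z' - z‖)
    (φ := innerSL ℝ (P.gradH z μ)) (fun x _ => (P.hasFDerivAt_smoothH hμ.1 x).hasFDerivWithinAt)
    (fun x hx => ?_) (convex_segment z z') (left_mem_segment ℝ z z') (right_mem_segment ℝ z z')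
  · have h := (abs_le.1 hmv).2
    rw [innerSL_apply_apply] at h
    unfold smoothObjective
    linarith
  · rw [← map_sub, innerSL_apply_norm, div_mul_eq_mul_div, le_div_iff₀ hμ.1]
    have h := (hLg μ hμ).dist_le_mul x (P.convex_box.segment_subset hb hb' hx) z hb
    simp only [dist_eq_norm, ← smul_sub, norm_smul, Real.norm_of_nonneg hμ.1.le] at h
    have hxz : ‖x - z‖ ≤ ‖z' - z‖ := by
      obtain ⟨t, ht, rfl⟩ := (segment_eq_image' ℝ z z' ▸ hx)
      rw [add_sub_cancel_left, norm_smul, Real.norm_of_nonneg ht.1]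
      exact mul_le_of_le_one_left (norm_nonneg _) ht.2
    have h' := mul_le_mul_of_nonneg_left hxz LgradH.coe_nonneg
    rw [mul_comm]
    exact h.trans h'

end Step

/-! ### Consistency of the gradients of the smoothing -/

/-- The gradients of the smoothings of `kinkPart` stay bounded as `μ ↓ 0`. -/
lemma exists_norm_fderiv_smoothKink_le (p : Var N₀ N₁ N) :
    ∃ K, ∃ δ > 0, ∀ z μ, 0 < μ → ‖z - p‖ + μ * ‖biasDir N₀ N₁ N‖ < δ →
      ‖fderiv ℝ (fun y => P.smoothKink y μ) z‖ ≤ K := by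
  obtain ⟨K, s, hs, hK⟩ := P.locallyLipschitz_kinkPart p
  obtain ⟨r, hr, hrs⟩ := Metric.mem_nhds_iff.1 hs
  refine ⟨K, r / 2, by positivity, fun z μ hμ hz => ?_⟩
  have hd := ((P.contDiff_smoothKink hμ).differentiable one_ne_zero z).hasFDerivAt
  have hle : ∀ d : Var N₀ N₁ N, ‖d‖ = 1 → fderiv ℝ (fun y => P.smoothKink y μ) z d ≤ K := by
    intro d hd₁
    simp only [P.smoothKink_eq_integral hμ.le] at hd ⊢
    refine fderiv_average_shift_le P.continuous_kinkPart (half_pos hr) (fun y hy t ht => ?_)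
      hμ.le hz hd
    rw [mem_ball_iff_norm] at hy
    have htd : ‖t • d‖ = t := by rw [norm_smul, hd₁, mul_one, Real.norm_of_nonneg ht.1.le]
    have hm₁ : y ∈ s := hrs (mem_ball_iff_norm.2 (by linarith))
    have hm₂ : y + t • d ∈ s := by
      refine hrs (mem_ball_iff_norm.2 ?_)
      rw [show y + t • d - p = y - p + t • d by abel]
      linarith [norm_add_le (y - p) (t • d), ht.2]
    have := hK.dist_le_mul _ hm₂ _ hm₁
    rw [dist_eq_norm, dist_eq_norm, add_sub_cancel_left, htd] at this
    exact (le_abs_self _).trans this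
  refine ContinuousLinearMap.opNorm_le_of_unit_norm K.2 fun d hd₁ => abs_le.2 ⟨?_, hle d hd₁⟩
  have := hle (-d) (by rwa [norm_neg])
  rw [map_neg] at this
  linarith

/-- If the derivatives of the smoothings of `kinkPart` at `z k → p` with `μ k ↓ 0` converge to `D`,
then `D` plus the derivative of the smooth terms cannot be nonnegative in a direction in which the
generalized directional derivative of the objective is negative. -/
lemma clarkeDeriv_objective_nonneg {p d : Var N₀ N₁ N} {z : ℕ → Var N₀ N₁ N} {μ : ℕ → ℝ}
    (hz : Tendsto z atTop (𝓝 p)) (hμ : Tendsto μ atTop (𝓝 0)) (hpos : ∀ k, 0 < μ k)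
    {D : Var N₀ N₁ N →L[ℝ] ℝ}
    (hD : Tendsto (fun k => fderiv ℝ (fun y => P.smoothKink y (μ k)) (z k)) atTop (𝓝 D))
    (hd : 0 ≤ fderiv ℝ P.smoothPart p d + P.regDeriv p d + D d) :
    0 ≤ clarkeDeriv P.objective p d := by
  by_contra! hneg
  obtain ⟨c, hc, δ₁, hδ₁, h₁⟩ := exists_forall_sub_le_of_clarkeDeriv_neg hneg
  have hS := (P.contDiff_smoothPart.contDiffAt (x := p)).hasStrictFDerivAt one_ne_zero |>.add
    ((P.contDiff_regularizer.contDiffAt (x := p)).hasStrictFDerivAt one_ne_zero)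
  obtain ⟨δ₂, hδ₂, h₂⟩ := exists_forall_abs_sub_le_of_hasStrictFDerivAt hS d
    (ε := -c / 2) (by linarith)
  set s := fderiv ℝ P.smoothPart p d + P.regDeriv p d with hs
  have hkink : ∀ y ∈ Metric.ball p (min δ₁ δ₂), ∀ t ∈ Ioo 0 (min δ₁ δ₂),
      P.kinkPart (y + t • d) - P.kinkPart y ≤ (c / 2 - s) * t := by
    intro y hy t ht
    have ha := h₁ y (Metric.ball_subset_ball (min_le_left _ _) hy) t
      ⟨ht.1, ht.2.trans_le (min_le_left _ _)⟩
    have hb := (abs_le.1 (h₂ y (Metric.ball_subset_ball (min_le_right _ _) hy) t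
      ⟨ht.1, ht.2.trans_le (min_le_right _ _)⟩)).1
    simp only [Pi.add_apply, _root_.add_apply, fderiv_regularizer_apply,
      ← hs] at hb
    rw [objective_eq, objective_eq] at ha
    linarith
  have hlim : D d ≤ c / 2 - s := by
    have hDd : Tendsto (fun k => fderiv ℝ (fun y => P.smoothKink y (μ k)) (z k) d)
        atTop (𝓝 (D d)) :=
      ((ContinuousLinearMap.apply ℝ ℝ d).continuous.tendsto D).comp hD
    refine le_of_tendsto hDd ?_
    have hsmall : Tendsto (fun k => ‖z k - p‖ + μ k * ‖biasDir N₀ N₁ N‖) atTop (𝓝 0) := by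
      simpa using (tendsto_iff_norm_sub_tendsto_zero.1 hz).add (hμ.mul_const ‖biasDir N₀ N₁ N‖)
    filter_upwards [hsmall.eventually (gt_mem_nhds (lt_min hδ₁ hδ₂))] with k hk
    have hdk := ((P.contDiff_smoothKink (hpos k)).differentiable one_ne_zero (z k)).hasFDerivAt
    simp only [P.smoothKink_eq_integral (hpos k).le] at hdk ⊢
    exact fderiv_average_shift_le P.continuous_kinkPart (lt_min hδ₁ hδ₂) hkink (hpos k).le hk hdk
  linarith

/-! ### The sequences generated by the algorithm -/

section Sequence

variable {τ₁ τ₂ τ₃ : ℝ} {z : ℕ → Var N₀ N₁ N} {μ L : ℕ → ℝ}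

/-- The updates of the parameters, whatever the outcome of the test. -/
lemma IsSPG.update (h : P.IsSPG τ₁ τ₂ τ₃ z μ L) (k : ℕ) :
    (μ (k + 1) = μ k ∧ L (k + 1) = L k) ∨ (μ (k + 1) = τ₁ * μ k ∧ L (k + 1) = τ₃ * L k) :=
  (em _).imp (h.keep k) (h.shrink k)

lemma IsSPG.mem_feasible (h : P.IsSPG τ₁ τ₂ τ₃ z μ L) : ∀ k, z k ∈ P.feasible
  | 0 => h.z_zero
  | k + 1 => h.step_mem k

lemma IsSPG.param_bounds (h : P.IsSPG τ₁ τ₂ τ₃ z μ L) (hτ : 1 ≤ τ₁ * τ₃) (k : ℕ) :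
    μ k ∈ Ioo (0 : ℝ) 1 ∧ 1 ≤ L k ∧ μ 0 * L 0 ≤ μ k * L k := by
  induction k with
  | zero => exact ⟨h.μ_zero, h.L_zero, le_rfl⟩
  | succ k ih =>
    obtain ⟨hμ, hL, hμL⟩ := ih
    rcases h.update P k with ⟨e₁, e₂⟩ | ⟨e₁, e₂⟩ <;> rw [e₁, e₂]
    · exact ⟨hμ, hL, hμL⟩
    · refine ⟨⟨mul_pos h.τ₁_mem.1 hμ.1, (mul_lt_of_lt_one_left hμ.1 h.τ₁_mem.2).trans hμ.2⟩,
        one_le_mul_of_one_le_of_one_le h.τ₃_ge hL, hμL.trans ?_⟩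
      rw [mul_mul_mul_comm]
      exact le_mul_of_one_le_left (mul_nonneg hμ.1.le (zero_le_one.trans hL)) hτ

lemma IsSPG.antitone_mu (h : P.IsSPG τ₁ τ₂ τ₃ z μ L) (hτ : 1 ≤ τ₁ * τ₃) : Antitone μ := by
  refine antitone_nat_of_succ_le fun k => ?_
  rcases h.update P k with e | e
  · exact e.1.le
  · rw [e.1]
    exact mul_le_of_le_one_left (h.param_bounds P hτ k).1.1.le h.τ₁_mem.2.le

/-- Along the indices at which the smoothing parameter shrinks, it tends to zero. -/
lemma IsSPG.tendsto_mu (h : P.IsSPG τ₁ τ₂ τ₃ z μ L) (hτ : 1 ≤ τ₁ * τ₃) {φ : ℕ → ℕ}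
    (hφ : StrictMono φ) (hK : ∀ j, μ (φ j + 1) = τ₁ * μ (φ j)) :
    Tendsto (fun j => μ (φ j)) atTop (𝓝 0) := by
  have hle : ∀ j, μ (φ j) ≤ τ₁ ^ j * μ (φ 0) := by
    intro j
    induction j with
    | zero => simp
    | succ j ih =>
      calc μ (φ (j + 1)) ≤ μ (φ j + 1) := h.antitone_mu P hτ (hφ (Nat.lt_succ_self j))
        _ = τ₁ * μ (φ j) := hK j
        _ ≤ τ₁ * (τ₁ ^ j * μ (φ 0)) := mul_le_mul_of_nonneg_left ih h.τ₁_mem.1.le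
        _ = τ₁ ^ (j + 1) * μ (φ 0) := by ring
  refine squeeze_zero (fun j => (h.param_bounds P hτ _).1.1.le) hle ?_
  simpa using (tendsto_pow_atTop_nhds_zero_of_lt_one h.τ₁_mem.1.le h.τ₁_mem.2).mul_const (μ (φ 0))

variable {LH LgradH : ℝ≥0}

/-- The iterates stay in the interior of the level set, so the Lipschitz constants apply at every
step and the smoothed objective descends. -/
lemma IsSPG.invariant (h : P.IsSPG τ₁ τ₂ τ₃ z μ L) (hN₀ : 0 < N₀) (hN₁ : 0 < N₁)
    (h₁ : 0 < P.lam₁) (h₂ : 0 < P.lam₂) (hβ : 0 ≤ P.β) (hθ : 0 < P.θ)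
    (hLH : P.IsLipConstH LH) (hLg : P.IsLipConstGradH LgradH) (hτ : 1 ≤ τ₁ * τ₃)
    (hz₀ : P.smoothObjective (z 0) (μ 0) + μ 0 * P.negPart < P.θ)
    (hL₀ : max (6 * P.lam₂ * N₁ * N₀
          + 2 / P.η * (((N₀ * N₁ + N₁ + N₀ + N₁ * N : ℕ) : ℝ) * LH + P.lam₁ * N₁ * N))
        (8 * P.lam₂ + LgradH) ≤ μ 0 * L 0) (k : ℕ) :
    z k ∈ P.levelSet ∧
      P.smoothObjective (z (k + 1)) (μ k) + (L k - LgradH / μ k) * ‖z (k + 1) - z k‖ ^ 2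
        ≤ P.smoothObjective (z k) (μ k) := by
  have step : ∀ k, P.smoothObjective (z k) (μ k) + μ k * P.negPart < P.θ → z k ∈ P.levelSet ∧
      P.smoothObjective (z (k + 1)) (μ k) + (L k - LgradH / μ k) * ‖z (k + 1) - z k‖ ^ 2
        ≤ P.smoothObjective (z k) (μ k) := by
    intro k hk
    obtain ⟨hμ, -, hμL⟩ := h.param_bounds P hτ k
    have hz := h.mem_feasible P k
    have hobj := (P.objective_le_smoothObjective_add hβ hμ.1.le (z k)).trans_lt hk
    have hlev : z k ∈ P.levelSet := ⟨hz.1, hobj.le⟩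
    have hd := P.norm_step_le h₁ h₂ hβ hN₀ hN₁ hθ hμ hLH (((le_max_left _ _).trans hL₀).trans hμL)
      hz (h.step_mem k) hobj (h.step_min k)
    have hself := P.mem_box_of_norm_step_le hN₀ hN₁ h₁ h₂ hβ hlev hz
      (by simpa using (P.eta_pos h₁ hθ).le)
    exact ⟨hlev, P.smoothObjective_step_le h₂.le hμ hLg hz (h.step_mem k) hself
      (P.mem_box_of_norm_step_le hN₀ hN₁ h₁ h₂ hβ hlev (h.step_mem k) hd) (h.step_min k)⟩
  refine step k ?_
  induction k with
  | zero => exact hz₀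
  | succ k ih =>
    obtain ⟨hμ, -, hμL⟩ := h.param_bounds P hτ k
    have hdec := (step k ih).2
    have hcoef : 0 ≤ L k - LgradH / μ k := by
      rw [sub_nonneg, div_le_iff₀ hμ.1]
      linarith [(le_max_right _ _).trans hL₀]
    have := P.smoothObjective_add_le hβ (h.param_bounds P hτ (k + 1)).1.1.le
      (h.antitone_mu P hτ k.le_succ) (z (k + 1))
    have := mul_nonneg hcoef (sq_nonneg ‖z (k + 1) - z k‖)
    linarith

/-- If the test fails, the descent estimate bounds the step: the constant `c` is the fraction of
`L` that is left after `LgradH / μ` is subtracted from it. -/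
lemma IsSPG.sq_step_le (h : P.IsSPG τ₁ τ₂ τ₃ z μ L) (h₂ : 0 < P.lam₂) (hτ : 1 ≤ τ₁ * τ₃)
    (hL₀ : 8 * P.lam₂ + LgradH ≤ μ 0 * L 0) {k : ℕ}
    (hdec : P.smoothObjective (z (k + 1)) (μ k) + (L k - LgradH / μ k) * ‖z (k + 1) - z k‖ ^ 2
        ≤ P.smoothObjective (z k) (μ k))
    (hk : μ (k + 1) = τ₁ * μ k) :
    (L k * ‖z (k + 1) - z k‖) ^ 2 ≤ τ₂ / (8 * P.lam₂ / (8 * P.lam₂ + LgradH)) * μ k := by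
  obtain ⟨hμ, hL, hμL⟩ := h.param_bounds P hτ k
  have hLpos : 0 < L k := zero_lt_one.trans_le hL
  have hq : 0 < 8 * P.lam₂ + LgradH := by positivity
  -- The parameter has shrunk strictly, so the test must have failed.
  have hfail : ¬ P.SufficientDecrease τ₂ (z k) (z (k + 1)) (μ k) (L k) := by
    intro hs
    have := mul_lt_of_lt_one_left hμ.1 h.τ₁_mem.2
    linarith [(h.keep k hs).1]
  rw [SufficientDecrease, not_lt] at hfail
  have hc : 8 * P.lam₂ / (8 * P.lam₂ + LgradH) * L k ≤ L k - LgradH / μ k := by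
    have h₃ : LgradH / μ k ≤ LgradH / (8 * P.lam₂ + LgradH) * L k := by
      rw [div_mul_eq_mul_div, div_le_div_iff₀ hμ.1 hq, mul_assoc, mul_comm (L k)]
      exact mul_le_mul_of_nonneg_left (hL₀.trans hμL) LgradH.coe_nonneg
    have h₄ : 8 * P.lam₂ / (8 * P.lam₂ + LgradH) * L k + LgradH / (8 * P.lam₂ + LgradH) * L k
        = L k := by
      rw [← add_mul, ← add_div, div_self hq.ne', one_mul]
    linarith
  rw [div_mul_eq_mul_div, le_div_iff₀ (by positivity)]
  have h₅ := mul_le_mul_of_nonneg_right hc (sq_nonneg ‖z (k + 1) - z k‖)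
  have h₆ : 8 * P.lam₂ / (8 * P.lam₂ + LgradH) * L k * ‖z (k + 1) - z k‖ ^ 2
      ≤ τ₂ * (μ k / L k) := by linarith
  have h₇ := mul_le_mul_of_nonneg_right h₆ hLpos.le
  rw [mul_assoc τ₂, div_mul_cancel₀ _ hLpos.ne'] at h₇
  refine le_trans (le_of_eq ?_) h₇
  ring

/-- The optimality conditions of the subproblems pass to the limit as a variational inequality over
the feasible set, and by scaling to the tangent cone. -/
lemma IsSPG.isGenDStationary (h : P.IsSPG τ₁ τ₂ τ₃ z μ L) (hN₀ : 0 < N₀) (hN₁ : 0 < N₁)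
    (h₁ : 0 < P.lam₁) (h₂ : 0 < P.lam₂) (hβ : 0 ≤ P.β) (hθ : 0 < P.θ)
    (hLH : P.IsLipConstH LH) (hLg : P.IsLipConstGradH LgradH) (hτ : 1 ≤ τ₁ * τ₃)
    (hz₀ : P.smoothObjective (z 0) (μ 0) + μ 0 * P.negPart < P.θ)
    (hL₀ : max (6 * P.lam₂ * N₁ * N₀
          + 2 / P.η * (((N₀ * N₁ + N₁ + N₀ + N₁ * N : ℕ) : ℝ) * LH + P.lam₁ * N₁ * N))
        (8 * P.lam₂ + LgradH) ≤ μ 0 * L 0) {p : Var N₀ N₁ N}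
    (hp : IsAccumulationPoint z {k | μ (k + 1) = τ₁ * μ k} p) :
    IsGenDStationary P.objective P.feasible p := by
  obtain ⟨φ, hφ, hK, hlim⟩ := hp
  simp only [mem_ofPred_eq] at hK
  have hμlim := h.tendsto_mu P hτ hφ hK
  have hμpos : ∀ k, 0 < μ k := fun k => (h.param_bounds P hτ k).1.1
  -- The scaled steps and the steps tend to zero along the subsequence.
  have hscaled : Tendsto (fun j => L (φ j) • (z (φ j + 1) - z (φ j))) atTop (𝓝 0) := by
    refine squeeze_zero_norm (a := fun j => √(τ₂ / (8 * P.lam₂ / (8 * P.lam₂ + LgradH)) * μ (φ j)))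
      (fun j => ?_) ?_
    · rw [norm_smul, Real.norm_of_nonneg (zero_le_one.trans (h.param_bounds P hτ _).2.1)]
      exact Real.le_sqrt_of_sq_le (h.sq_step_le P h₂ hτ ((le_max_right _ _).trans hL₀)
        (h.invariant P hN₀ hN₁ h₁ h₂ hβ hθ hLH hLg hτ hz₀ hL₀ _).2 (hK j))
    · simpa using (hμlim.const_mul (τ₂ / (8 * P.lam₂ / (8 * P.lam₂ + LgradH)))).sqrt
  have hstep : Tendsto (fun j => z (φ j + 1)) atTop (𝓝 p) := by
    have h0 : Tendsto (fun j => z (φ j + 1) - z (φ j)) atTop (𝓝 0) := by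
      refine squeeze_zero_norm (fun j => ?_) (tendsto_zero_iff_norm_tendsto_zero.1 hscaled)
      rw [norm_smul]
      exact le_mul_of_one_le_left (norm_nonneg _)
        ((h.param_bounds P hτ _).2.1.trans (le_abs_self _))
    simpa using h0.add hlim
  have hpf : p ∈ P.feasible :=
    P.isClosed_feasible.mem_of_tendsto hlim (Eventually.of_forall fun j => h.mem_feasible P _)
  -- A further subsequence makes the gradients of the smoothed kinks converge.
  obtain ⟨K, δ, hδ, hKδ⟩ := P.exists_norm_fderiv_smoothKink_le p
  have hsmall : Tendsto (fun j => ‖z (φ j) - p‖ + μ (φ j) * ‖biasDir N₀ N₁ N‖) atTop (𝓝 0) := by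
    simpa using
      (tendsto_iff_norm_sub_tendsto_zero.1 hlim).add (hμlim.mul_const ‖biasDir N₀ N₁ N‖)
  have hbdd : ∀ᶠ j in atTop, fderiv ℝ (fun y => P.smoothKink y (μ (φ j))) (z (φ j)) ∈
      Metric.closedBall (0 : Var N₀ N₁ N →L[ℝ] ℝ) K := by
    filter_upwards [hsmall.eventually_lt_const hδ] with j hj
    rw [mem_closedBall_zero_iff]
    exact hKδ _ _ (hμpos _) hj
  have : ProperSpace (Var N₀ N₁ N →L[ℝ] ℝ) := FiniteDimensional.proper ℝ _
  obtain ⟨D, -, ψ, hψ, hD⟩ :=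
    tendsto_subseq_of_frequently_bounded Metric.isBounded_closedBall hbdd.frequently
  have hψt := hψ.tendsto_atTop
  -- The optimality conditions of the subproblems pass to the limit.
  have hvar : ∀ y ∈ P.feasible,
      0 ≤ fderiv ℝ P.smoothPart p (y - p) + P.regDeriv p (y - p) + D (y - p) := by
    intro y hy
    have hA : Tendsto (fun j => fderiv ℝ P.smoothPart (z (φ (ψ j)))) atTop
        (𝓝 (fderiv ℝ P.smoothPart p)) :=
      ((P.contDiff_smoothPart.continuous_fderiv one_ne_zero).tendsto p).comp (hlim.comp hψt)
    have hw : Tendsto (fun j => y - z (φ (ψ j) + 1)) atTop (𝓝 (y - p)) :=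
      tendsto_const_nhds.sub (hstep.comp hψt)
    have hap : Continuous fun q : (Var N₀ N₁ N →L[ℝ] ℝ) × Var N₀ N₁ N => q.1 q.2 :=
      isBoundedBilinearMap_apply.continuous
    have hR := (P.continuous_regDeriv.tendsto (p, y - p)).comp
      ((hstep.comp hψt).prodMk_nhds hw)
    have h3 := ((hap.tendsto _).comp (hA.prodMk_nhds hw)).add
      hR |>.add ((hap.tendsto _).comp (hD.prodMk_nhds hw)) |>.add ((hscaled.comp hψt).inner hw)
    rw [inner_zero_left, add_zero] at h3
    refine ge_of_tendsto h3 (Eventually.of_forall fun j => ?_)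
    have hv := P.variational_of_isMinOn (h.step_mem (φ (ψ j))) (h.step_min _) hy
    have hg : innerSL ℝ (P.gradH (z (φ (ψ j))) (μ (φ (ψ j)))) =
        fderiv ℝ P.smoothPart (z (φ (ψ j)))
          + fderiv ℝ (fun y => P.smoothKink y (μ (φ (ψ j)))) (z (φ (ψ j))) := by
      have hs := ((P.contDiff_smoothPart.differentiable one_ne_zero
        (z (φ (ψ j)))).hasFDerivAt).add ((P.contDiff_smoothKink (hμpos (φ (ψ j)))).differentiable
        one_ne_zero (z (φ (ψ j)))).hasFDerivAt
      have hH := P.hasFDerivAt_smoothH (hμpos (φ (ψ j))) (z (φ (ψ j)))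
      simp only [smoothH_eq] at hH
      exact hH.unique hs
    have hg' := DFunLike.congr_fun hg (y - z (φ (ψ j) + 1))
    rw [innerSL_apply_apply, _root_.add_apply] at hg'
    rw [hg'] at hv
    simp only [Function.comp_apply]
    linarith
  refine ⟨hpf, fun d hd => ?_⟩
  refine P.clarkeDeriv_objective_nonneg (hlim.comp hψt) (hμlim.comp hψt) (fun j => hμpos _) hD ?_
  -- The variational inequality at `y n - p`, divided by `τ n`, passes to the tangent direction `d`.
  obtain ⟨y, τ, hy, hτpos, -, -, hyd⟩ := hd
  have hcont : Continuous fun d : Var N₀ N₁ N =>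
      fderiv ℝ P.smoothPart p d + P.regDeriv p d + D d :=
    ((fderiv ℝ P.smoothPart p).continuous.add
      (P.continuous_regDeriv.comp (by fun_prop : Continuous fun d => (p, d)))).add D.continuous
  refine ge_of_tendsto ((hcont.tendsto d).comp hyd) (Eventually.of_forall fun n => ?_)
  have := mul_nonneg (inv_pos.2 (hτpos n)).le (hvar (y n) (hy n))
  simp only [Function.comp_apply, regDeriv_smul, map_smul, smul_eq_mul]
  linarith

end Sequence

end Model

end Autoencoder

/-! ### Accumulation points are stationary -/

theorem mainTheorem1 {N₀ N₁ N : ℕ} (hN₀ : 0 < N₀) (hN₁ : 0 < N₁) (hN : 0 < N)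
    (P : Autoencoder.Model N₀ N₁ N)
    (hlam₁ : 0 < P.lam₁) (hlam₂ : 0 < P.lam₂) (hβ : 0 < P.β)
    (hθ : 1 / N * P.normXFsq < P.θ)
    (LH LgradH : ℝ≥0) (hLH : P.IsLipConstH LH) (hLgradH : P.IsLipConstGradH LgradH)
    (τ₁ τ₂ τ₃ : ℝ) (hτ : 1 ≤ τ₁ * τ₃)
    (z : ℕ → Autoencoder.Var N₀ N₁ N) (μ L : ℕ → ℝ) (hSPG : P.IsSPG τ₁ τ₂ τ₃ z μ L)
    (hz₀ : P.smoothObjective (z 0) (μ 0) + μ 0 * P.negPart < P.θ)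
    (hL₀ : max (6 * P.lam₂ * N₁ * N₀
          + 2 / P.η * (((N₀ * N₁ + N₁ + N₀ + N₁ * N : ℕ) : ℝ) * LH + P.lam₁ * N₁ * N))
        (8 * P.lam₂ + LgradH) ≤ μ 0 * L 0) :
    Bornology.IsBounded (z '' {k | μ (k + 1) = τ₁ * μ k}) ∧
    ∀ zs : Autoencoder.Var N₀ N₁ N,
      Autoencoder.IsAccumulationPoint z {k | μ (k + 1) = τ₁ * μ k} zs →
        Autoencoder.IsGenDStationary P.objective P.feasible zs ∧
        (Autoencoder.ClarkeRegularAt P.objective zs →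
          Autoencoder.IsDStationary P.objective P.feasible zs) := by
  have hθ' : 0 < P.θ := by
    refine lt_of_le_of_lt ?_ hθ
    unfold Autoencoder.Model.normXFsq
    positivity
  refine ⟨P.isBounded_box.subset ?_, fun zs hzs => ?_⟩
  · rintro _ ⟨k, -, rfl⟩
    exact P.mem_box_of_norm_step_le hN₀ hN₁ hlam₁ hlam₂ hβ.le
      (hSPG.invariant P hN₀ hN₁ hlam₁ hlam₂ hβ.le hθ' hLH hLgradH hτ hz₀ hL₀ k).1
      (hSPG.mem_feasible P k) (by simpa using (P.eta_pos hlam₁ hθ').le)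
  · have hst := hSPG.isGenDStationary P hN₀ hN₁ hlam₁ hlam₂ hβ.le hθ' hLH hLgradH hτ hz₀ hL₀ hzs
    refine ⟨hst, fun hreg => ⟨hst.1, fun d hd => ?_⟩⟩
    obtain ⟨l, hl, he⟩ := hreg d
    exact ⟨l, hl, by exact_mod_cast he ▸ hst.2 d hd⟩
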